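/- Let $1\le m<n$ and let $A\in\mathbb Z^{m\times n}$ be an integer matrix with columns $v_1,\dots,v_n\in\mathbb Z^m$ such that (i) the greatest common divisor of all $m\times m$ minors of $A$ is $1$, and (ii) $\{x\in\mathbb R^n_{\ge 0}: Ax=0\}=\{0\}$. Put $v=v_1+\dots+v_n$ and $C=\{\lambda_1v_1+\dots+\lambda_nv_n:\lambda_1,\dots,\lambda_n\ge 0\}$. Call a real number $t\ge 0$ admissible if for every $b\in(tv+C)\cap\mathbb Z^m$ there is an integer vector $z\in\mathbb Z^n$ with $z\ge 0$ and $Az=b$, and let the diagonal Frobenius number $\mathrm g(A)$ be the infimum of all admissible $t$. Then $$\mathrm g(A)\le c_{m,n}\sqrt{\det(AA^T)},\qquad c_{m,n}=\frac{(n-m)\,2^{\,n-m-1}}{\omega_{n-m}},$$ where $\omega_k$ denotes the volume of the $k$-dimensional Euclidean unit ball. Moreover, the number $c_{m,n}\sqrt{\det(AA^T)}$ is itself admissible; in particular, admissible numbers exist and $\mathrm g(A)$ is well defined. -/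

import Mathlib

noncomputable section

namespace Knapsack

/-- The greatest common divisor of all `m × m` minors of `A`
(one minor for each choice of `m` columns `I 0 < ⋯ < I (m - 1)`). -/
def minorsGcd {m n : ℕ} (A : Matrix (Fin m) (Fin n) ℤ) : ℤ :=
  (Finset.univ : Finset (Fin m ↪o Fin n)).gcd fun I => (A.submatrix id I).det

/-- The real matrix with the same entries as `A`. -/
def toReal {m n : ℕ} (A : Matrix (Fin m) (Fin n) ℤ) : Matrix (Fin m) (Fin n) ℝ :=
  A.map fun a : ℤ => (a : ℝ)

/-- The knapsack polytope `P(A, b) = {x ∈ ℝⁿ : x ≥ 0, A x = b}`. -/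
def polytope {m n : ℕ} (A : Matrix (Fin m) (Fin n) ℤ) (b : Fin m → ℝ) : Set (Fin n → ℝ) :=
  {x | (∀ j, 0 ≤ x j) ∧ (toReal A).mulVec x = b}

/-- The set `F(A)` of all `b ∈ ℤᵐ` such that `P(A, b)` contains an integer vector. -/
def feasibleSet {m n : ℕ} (A : Matrix (Fin m) (Fin n) ℤ) : Set (Fin m → ℤ) :=
  {b | ∃ z : Fin n → ℤ, (fun j => (z j : ℝ)) ∈ polytope A (fun i => (b i : ℝ))}

/-- The `j`-th column `v_j` of `A`, as a real vector. -/
def column {m n : ℕ} (A : Matrix (Fin m) (Fin n) ℤ) (j : Fin n) : Fin m → ℝ :=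
  fun i => (A i j : ℝ)

/-- The cone `C` generated by the columns of `A`. -/
def cone {m n : ℕ} (A : Matrix (Fin m) (Fin n) ℤ) : Set (Fin m → ℝ) :=
  {y | ∃ c : Fin n → ℝ, (∀ j, 0 ≤ c j) ∧ y = ∑ j, c j • column A j}

/-- The sum `v = v_1 + ⋯ + v_n` of the columns of `A`. -/
def columnSum {m n : ℕ} (A : Matrix (Fin m) (Fin n) ℤ) : Fin m → ℝ :=
  ∑ j, column A j

/-- The set of all `t ≥ 0` such that every integer vector `b` in `t v + C` belongs to `F(A)`. -/
def admissibleShifts {m n : ℕ} (A : Matrix (Fin m) (Fin n) ℤ) : Set ℝ :=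
  {t | 0 ≤ t ∧ ∀ b : Fin m → ℤ,
    (∃ y ∈ cone A, (fun i => (b i : ℝ)) = t • columnSum A + y) → b ∈ feasibleSet A}

/-- The diagonal Frobenius number `g(A)`: the infimum of the admissible `t`. The set of admissible
`t` is an up-set of `[0, ∞)` which may be an open half-line (for `A = (2 3)` it is `(1/5, ∞)`), so
that its least element has to be read as its infimum. -/
def diagFrobenius {m n : ℕ} (A : Matrix (Fin m) (Fin n) ℤ) : ℝ :=
  sInf (admissibleShifts A)

/-- The volume `ω_k` of the unit ball of the `k`-dimensional Euclidean space. -/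
def ballVolume (k : ℕ) : ℝ :=
  (MeasureTheory.volume (Metric.closedBall (0 : EuclideanSpace ℝ (Fin k)) 1)).toReal

/-- The constant `c_{m,n} = (n - m) 2 ^ (n - m - 1) / ω_{n - m}`, used for `m < n`. -/
def frobeniusConst (m n : ℕ) : ℝ :=
  ((n : ℝ) - (m : ℝ)) * 2 ^ (n - m - 1) / ballVolume (n - m)

end Knapsack

end

/-! Let k = n - m. A point b of tv + C is Ax for a real x with all entries at least t, and coprime
minors give an integer z with Az = b (`exists_int_mulVec_eq`). As x - z lies in the kernel, it
suffices to approximate kernel points entrywise within t by integer ones. Rounding coordinates in a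
basis of k integer kernel vectors of length at most r costs at most kr/2. Such a basis exists for r
= 2^k √det(AAᵀ) / ω_k (`span_shortKernelVectors`). Otherwise some unit kernel vector e is orthogonal
to all these short vectors, and Minkowski's theorem, applied to the unit ball of the kernel
stretched along e by a factor exceeding r, yields a nonzero integer vector that can be neither short
nor long. -/

namespace Knapsack

open MeasureTheory Matrix

/-! ### Minkowski's theorem and the body it is applied to -/

/-- Minkowski's convex body theorem for the preimage of a convex body under an invertible matrix. -/
theorem exists_int_ne_zero_mulVec_mem {ι : Type*} [Fintype ι] [DecidableEq ι]
    (N : Matrix ι ι ℝ) (hN : N.det ≠ 0) (S : Set (ι → ℝ))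
    (hsymm : ∀ x ∈ S, -x ∈ S) (hconv : Convex ℝ S)
    (hvol : ENNReal.ofReal (2 ^ Fintype.card ι * |N.det|) < volume S) :
    ∃ z : ι → ℤ, z ≠ 0 ∧ N *ᵥ (fun i => (z i : ℝ)) ∈ S := by
  classical
  have hdet : LinearMap.det (Matrix.toLin' N) ≠ 0 := by simpa using hN
  have hfund := ZSpan.isAddFundamentalDomain' (Pi.basisFun ℝ ι) volume
  have hdom : volume (ZSpan.fundamentalDomain (Pi.basisFun ℝ ι)) = 1 := by
    simp [ZSpan.fundamentalDomain_pi_basisFun, volume_pi_pi]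
  have : Countable (Submodule.span ℤ (Set.range (Pi.basisFun ℝ ι))).toAddSubgroup :=
    inferInstanceAs (Countable (Submodule.span ℤ (Set.range (Pi.basisFun ℝ ι))))
  obtain ⟨x, hx, hxS⟩ := exists_ne_zero_mem_lattice_of_measure_mul_two_pow_lt_measure
    (s := Matrix.toLin' N ⁻¹' S) hfund (fun x hx => by
      simpa [mulVec_neg] using hsymm _ hx) (hconv.linear_preimage _) (by
      rw [hdom, Measure.addHaar_preimage_linearMap _ hdet, Module.finrank_fintype_fun_eq_card,
        LinearMap.det_toLin', one_mul, abs_inv, ENNReal.ofReal_inv_of_pos (abs_pos.2 hN),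
        ← ENNReal.div_eq_inv_mul, ENNReal.lt_div_iff_mul_lt (by simp [hN]) (by simp)]
      convert hvol using 1
      rw [ENNReal.ofReal_mul (by positivity), ENNReal.ofReal_pow (by norm_num)]
      simp)
  have hmem : (x : ι → ℝ) ∈ Submodule.span ℤ (Set.range (Pi.basisFun ℝ ι)) := x.2
  rw [Module.Basis.mem_span_iff_repr_mem] at hmem
  choose z hz using hmem
  have hzx : (fun i => (z i : ℝ)) = x := by
    ext i
    simpa using hz i
  refine ⟨z, fun h => hx ?_, ?_⟩
  · ext i
    simp [← hzx, h]
  · rw [hzx]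
    exact hxS

/-- The product of an open cube and an open Euclidean ball. -/
def cubeBall (m k : ℕ) : Set (Fin m ⊕ Fin k → ℝ) :=
  {y | (∀ i, |y (Sum.inl i)| < 1) ∧ ∑ j, y (Sum.inr j) ^ 2 < 1}

theorem cubeBall_eq (m k : ℕ) : cubeBall m k =
    LinearMap.funLeft ℝ ℝ Sum.inl ⁻¹' (Metric.ball (0 : Fin m → ℝ) 1) ∩
      ((WithLp.linearEquiv 2 ℝ (Fin k → ℝ)).symm.toLinearMap ∘ₗ LinearMap.funLeft ℝ ℝ Sum.inr) ⁻¹'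
        (Metric.ball (0 : EuclideanSpace ℝ (Fin k)) 1) := by
  ext y
  simp only [cubeBall, Set.mem_ofPred_eq, Set.mem_inter_iff, Set.mem_preimage, mem_ball_zero_iff,
    pi_norm_lt_iff one_pos, ← sq_lt_one_iff₀ (norm_nonneg _), EuclideanSpace.real_norm_sq_eq]
  simp [LinearMap.funLeft_apply]

theorem convex_cubeBall (m k : ℕ) : Convex ℝ (cubeBall m k) := by
  rw [cubeBall_eq]
  exact ((convex_ball _ _).linear_preimage _).inter ((convex_ball _ _).linear_preimage _)

theorem neg_mem_cubeBall {m k : ℕ} (y : Fin m ⊕ Fin k → ℝ) (hy : y ∈ cubeBall m k) :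
    -y ∈ cubeBall m k := by
  simpa [cubeBall] using hy

theorem ballVolume_pos (k : ℕ) : 0 < ballVolume k :=
  ENNReal.toReal_pos (Metric.measure_closedBall_pos _ _ one_pos).ne'
    measure_closedBall_lt_top.ne

theorem volume_cubeBall (m k : ℕ) :
    volume (cubeBall m k) = ENNReal.ofReal (2 ^ m * ballVolume k) := by
  have h1 : cubeBall m k = MeasurableEquiv.sumPiEquivProdPi (fun _ => ℝ) ⁻¹'
      (Metric.ball (0 : Fin m → ℝ) 1 ×ˢ
        (WithLp.toLp 2 ⁻¹' Metric.ball (0 : EuclideanSpace ℝ (Fin k)) 1)) := by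
    rw [cubeBall_eq]
    rfl
  rw [h1, (volume_measurePreserving_sumPiEquivProdPi _).measure_preimage_equiv,
    Measure.volume_eq_prod, Measure.prod_prod, Real.volume_pi_ball _ one_pos,
    (PiLp.volume_preserving_toLp (Fin k)).measure_preimage
      measurableSet_ball.nullMeasurableSet, ← Measure.addHaar_unitClosedBall_eq_addHaar_unitBall,
    ENNReal.ofReal_mul (by positivity), ballVolume,
    ENNReal.ofReal_toReal measure_closedBall_lt_top.ne]
  simp

/-! ### Integer solutions of Az = b -/

/-- Every integer vector is an integer combination of the columns of `A` if the maximal minors of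
`A` are coprime. -/
theorem exists_int_mulVec_eq {m n : ℕ} (A : Matrix (Fin m) (Fin n) ℤ) (hgcd : minorsGcd A = 1)
    (b : Fin m → ℤ) : ∃ z : Fin n → ℤ, A *ᵥ z = b := by
  let R : Submodule ℤ (Fin m → ℤ) := LinearMap.range A.mulVecLin
  -- The multipliers a for which a • b is an integer combination of columns; by Cramer's rule every
  -- maximal minor is one.
  let J : Ideal ℤ := R.comap (LinearMap.toSpanSingleton ℤ (Fin m → ℤ) b)
  have hJ : ∀ I : Fin m ↪o Fin n, (A.submatrix id I).det ∈ J := by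
    intro I
    change (A.submatrix id I).det • b ∈ R
    have h := congrArg (fun M => M *ᵥ b) (mul_adjugate (A.submatrix id I))
    simp only [← mulVec_mulVec, smul_mulVec, one_mulVec] at h
    rw [← h]
    refine ⟨∑ i, Pi.single (I i) (((A.submatrix id I).adjugate *ᵥ b) i), ?_⟩
    ext i
    simp only [map_sum, mulVecLin_apply, mulVec_single, Finset.sum_apply]
    simp [mulVec, dotProduct, mul_comm]
  obtain ⟨g, hg⟩ := (IsPrincipalIdealRing.principal J).principal
  have hdvd : g ∣ 1 := by
    rw [← hgcd]
    refine Finset.dvd_gcd fun I _ => ?_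
    have := hJ I
    rw [hg] at this
    exact Ideal.mem_span_singleton.1 this
  have h1 : (1 : ℤ) ∈ J := by
    rw [hg]
    exact Ideal.mem_span_singleton.2 hdvd
  have h2 : (1 : ℤ) • b ∈ R := h1
  rw [one_smul] at h2
  exact h2

/-! ### Integer kernel points in a stretched ball -/

/-- A unit vector in the kernel of a surjective matrix is the first row of a matrix whose rows form
an orthonormal basis of the kernel. -/
theorem exists_orthonormal_rows {m n k : ℕ} (hn : n = m + k) (i₀ : Fin k)
    (B : Matrix (Fin m) (Fin n) ℝ) (hB : Function.Surjective B.mulVec)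
    (e : Fin n → ℝ) (he : B *ᵥ e = 0) (he1 : e ⬝ᵥ e = 1) :
    ∃ U : Matrix (Fin k) (Fin n) ℝ, U * Uᵀ = 1 ∧ B * Uᵀ = 0 ∧ U i₀ = e ∧
      ∀ x, B *ᵥ x = 0 → (U *ᵥ x) ⬝ᵥ (U *ᵥ x) = x ⬝ᵥ x := by
  let T : EuclideanSpace ℝ (Fin n) →ₗ[ℝ] (Fin m → ℝ) :=
    B.mulVecLin ∘ₗ (WithLp.linearEquiv 2 ℝ (Fin n → ℝ)).toLinearMap
  have hT : Function.Surjective T := by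
    intro y
    obtain ⟨x, hx⟩ := hB y
    exact ⟨WithLp.toLp 2 x, hx⟩
  have hrank : Module.finrank ℝ (LinearMap.ker T) = Fintype.card (Fin k) := by
    have := T.finrank_range_add_finrank_ker
    rw [LinearMap.range_eq_top.2 hT, finrank_top] at this
    simp at this ⊢
    omega
  let e' : LinearMap.ker T := ⟨WithLp.toLp 2 e, he⟩
  have hnorm : ‖e'‖ = 1 := by
    rw [← sq_eq_sq₀ (norm_nonneg _) zero_le_one, Submodule.coe_norm,
      EuclideanSpace.real_norm_sq_eq, one_pow, ← he1]
    simp [e', dotProduct, sq]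
  obtain ⟨b, hb⟩ := Orthonormal.exists_orthonormalBasis_extension_of_card_eq (𝕜 := ℝ) hrank
    (v := fun _ => e') (s := {i₀}) ⟨fun _ => hnorm, fun i j hij =>
      absurd (Subsingleton.elim i j) hij⟩
  refine ⟨Matrix.of fun i => (b i : EuclideanSpace ℝ (Fin n)).ofLp, ?_, ?_, ?_, ?_⟩
  · ext i j
    have := b.inner_eq_ite i j
    rw [Submodule.coe_inner, EuclideanSpace.inner_eq_star_dotProduct] at this
    rw [Matrix.one_apply, ← this, dotProduct_comm]
    rfl
  · ext i j
    have : B *ᵥ (b j : EuclideanSpace ℝ (Fin n)).ofLp = 0 := (b j).2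
    exact congrFun this i
  · have := hb i₀ rfl
    ext j
    simp [this, e']
  · intro x hx
    have := b.sum_sq_norm_inner_right (⟨WithLp.toLp 2 x, hx⟩ : LinearMap.ker T)
    rw [Submodule.coe_norm, EuclideanSpace.real_norm_sq_eq] at this
    simp only [Submodule.coe_inner, EuclideanSpace.inner_eq_star_dotProduct] at this
    convert this using 1
    · simp [dotProduct, mulVec, sq, mul_comm]
    · simp [dotProduct, sq]

theorem intCast_mulVec {m n : ℕ} (A : Matrix (Fin m) (Fin n) ℤ) (z : Fin n → ℤ) :
    toReal A *ᵥ (fun j => (z j : ℝ)) = fun i => ((A *ᵥ z) i : ℝ) := by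
  ext i
  simp [toReal, mulVec, dotProduct]

theorem det_toReal_mul_transpose {m n : ℕ} (A : Matrix (Fin m) (Fin n) ℤ) :
    (toReal A * (toReal A)ᵀ).det = (((A * Aᵀ).det : ℤ) : ℝ) := by
  have : toReal A * (toReal A)ᵀ = (A * Aᵀ).map (Int.castRingHom ℝ) := by
    rw [Matrix.map_mul, transpose_map]
    rfl
  rw [this]
  exact (RingHom.map_det (Int.castRingHom ℝ) _).symm

/-- Minkowski's theorem for the lattice of integer points in the kernel of `A` and the ellipsoid
obtained by stretching the unit ball of the kernel by the factor `ρ` in the direction `e`. -/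
theorem exists_int_mem_ker_mem_ellipsoid {m n k : ℕ} (hn : n = m + k) (hk : 0 < k)
    (A : Matrix (Fin m) (Fin n) ℤ) (hA : Function.Surjective (toReal A).mulVec)
    (e : Fin n → ℝ) (he : toReal A *ᵥ e = 0) (he1 : e ⬝ᵥ e = 1) (ρ : ℝ) (hρ : 0 < ρ)
    (hvol : 2 ^ k * √((A * Aᵀ).det : ℤ) < ballVolume k * ρ) :
    ∃ z : Fin n → ℤ, z ≠ 0 ∧ A *ᵥ z = 0 ∧
      (fun j => (z j : ℝ)) ⬝ᵥ (fun j => (z j : ℝ)) - (e ⬝ᵥ fun j => (z j : ℝ)) ^ 2 +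
        (e ⬝ᵥ fun j => (z j : ℝ)) ^ 2 / ρ ^ 2 < 1 := by
  let i₀ : Fin k := ⟨0, hk⟩
  obtain ⟨U, hU, hAU, hUe, hUx⟩ := exists_orthonormal_rows hn i₀ (toReal A) hA e he he1
  let d : Fin k → ℝ := fun i => if i = i₀ then ρ⁻¹ else 1
  have hd : ∀ i, d i ≠ 0 := by
    intro i
    simp only [d]
    split_ifs
    · exact inv_ne_zero hρ.ne'
    · exact one_ne_zero
  have hprod : ∏ i, d i = ρ⁻¹ := by simp [d]
  -- Working in all of ℝⁿ avoids the covolume of the kernel lattice: the open cube constrains Az,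
  -- which integrality then forces to be 0, while `d` maps the ellipsoid to the unit ball.
  let M : Matrix (Fin m ⊕ Fin k) (Fin n) ℝ := fromRows (toReal A) (diagonal d * U)
  let σ : Fin m ⊕ Fin k ≃ Fin n := finSumFinEquiv.trans (finCongr hn.symm)
  let N : Matrix (Fin m ⊕ Fin k) (Fin m ⊕ Fin k) ℝ := M.submatrix id σ
  have hUA : U * (toReal A)ᵀ = 0 := by
    rw [← transpose_transpose U, ← transpose_mul, hAU, transpose_zero]
  -- The rows of `U` are orthonormal and orthogonal to those of A, so the Gram matrix is block
  -- diagonal and gives |det N|.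
  have hNN : N * Nᵀ = fromBlocks (toReal A * (toReal A)ᵀ) 0 0 (diagonal d * diagonal d) := by
    have h1 : N * Nᵀ = M * Mᵀ := by
      simp only [N, transpose_submatrix, submatrix_mul_equiv, submatrix_id_id]
    rw [h1]
    simp only [M, transpose_fromRows, fromRows_mul_fromCols, transpose_mul, diagonal_transpose]
    congr 1
    · rw [← Matrix.mul_assoc, hAU, Matrix.zero_mul]
    · rw [Matrix.mul_assoc, hUA, Matrix.mul_zero]
    · rw [Matrix.mul_assoc, ← Matrix.mul_assoc U, hU, Matrix.one_mul]
  have hdetN : N.det ^ 2 = ((A * Aᵀ).det : ℤ) * (ρ⁻¹) ^ 2 := by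
    have := congrArg det hNN
    rw [det_mul, det_transpose, det_fromBlocks_zero₁₂, det_mul, det_diagonal, hprod,
      det_toReal_mul_transpose] at this
    rw [sq, sq, this]
  have hMx : ∀ y, N *ᵥ y = M *ᵥ (y ∘ σ.symm) := by
    intro y
    simp only [N, submatrix_mulVec_equiv, Function.comp_id]
  have hMinl : ∀ x i, (M *ᵥ x) (Sum.inl i) = (toReal A *ᵥ x) i := fun x i => by
    simp only [M, fromRows_mulVec, Sum.elim_inl]
  have hMinr : ∀ x i, (M *ᵥ x) (Sum.inr i) = d i * (U *ᵥ x) i := fun x i => by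
    simp only [M, fromRows_mulVec, Sum.elim_inr, ← mulVec_mulVec, mulVec_diagonal]
  have hN0 : N.det ≠ 0 := by
    intro h0
    obtain ⟨y, hy, hNy⟩ := exists_mulVec_eq_zero_iff.2 h0
    rw [hMx] at hNy
    have hx : toReal A *ᵥ (y ∘ σ.symm) = 0 := by
      ext i
      rw [← hMinl, hNy]
      rfl
    have hUx0 : U *ᵥ (y ∘ σ.symm) = 0 := by
      ext i
      have := hMinr (y ∘ σ.symm) i
      rw [hNy] at this
      exact (mul_eq_zero.1 this.symm).resolve_left (hd i)
    have := hUx _ hx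
    rw [hUx0, zero_dotProduct, eq_comm, dotProduct_self_eq_zero] at this
    apply hy
    ext i
    simpa using congrFun this (σ i)
  have habs : |N.det| = √((A * Aᵀ).det : ℤ) / ρ := by
    rw [← Real.sqrt_sq_eq_abs, hdetN, Real.sqrt_mul' _ (sq_nonneg _),
      Real.sqrt_sq (inv_pos.2 hρ).le, div_eq_mul_inv]
  obtain ⟨z, hz, hzmem⟩ := exists_int_ne_zero_mulVec_mem N hN0 (cubeBall m k)
    neg_mem_cubeBall (convex_cubeBall m k) (by
      rw [volume_cubeBall]
      refine (ENNReal.ofReal_lt_ofReal_iff (mul_pos (by positivity) (ballVolume_pos k))).2 ?_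
      rw [habs, Fintype.card_sum, Fintype.card_fin, Fintype.card_fin, pow_add, mul_assoc,
        ← mul_div_assoc]
      gcongr
      rwa [div_lt_iff₀ hρ])
  have hcomp : (fun i => (z i : ℝ)) ∘ σ.symm = fun j => ((z ∘ σ.symm) j : ℝ) := rfl
  rw [hMx, hcomp] at hzmem
  obtain ⟨hzA, hzU⟩ := hzmem
  set w : Fin n → ℤ := z ∘ σ.symm with hw
  have hAw : A *ᵥ w = 0 := by
    ext i
    have h : |((A *ᵥ w) i : ℝ)| < 1 := by simpa [hMinl, intCast_mulVec] using hzA i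
    exact Int.abs_lt_one_iff.1 (by exact_mod_cast h)
  have hAw' : toReal A *ᵥ (fun j => (w j : ℝ)) = 0 := by
    rw [intCast_mulVec, hAw]
    ext
    simp
  refine ⟨w, fun h => hz ?_, hAw, ?_⟩
  · ext i
    simpa [hw] using congrFun h (σ i)
  · have hnorm := hUx _ hAw'
    have he₀ : (U *ᵥ fun j => (w j : ℝ)) i₀ = e ⬝ᵥ fun j => (w j : ℝ) := by
      rw [← hUe]
      rfl
    simp only [hMinr] at hzU
    rw [← hnorm, ← he₀, dotProduct]
    rw [← Finset.add_sum_erase _ _ (Finset.mem_univ i₀)] at hzU ⊢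
    have hrest : ∑ i ∈ Finset.univ.erase i₀, (d i * (U *ᵥ fun j => (w j : ℝ)) i) ^ 2 =
        ∑ i ∈ Finset.univ.erase i₀,
          (U *ᵥ fun j => (w j : ℝ)) i * (U *ᵥ fun j => (w j : ℝ)) i := by
      refine Finset.sum_congr rfl fun i hi => ?_
      simp only [d, if_neg (Finset.ne_of_mem_erase hi)]
      ring
    rw [hrest] at hzU
    simp only [d, if_true] at hzU
    calc _ = _ := ?_
      _ < 1 := hzU
    field_simp
    ring

/-! ### Short integer vectors span the kernel -/

/-- A proper subspace of `K` is orthogonal to some unit vector of `K`. -/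
theorem exists_unit_dotProduct_eq_zero {n : ℕ} {W K : Submodule ℝ (Fin n → ℝ)} (hWK : W < K) :
    ∃ e ∈ K, e ⬝ᵥ e = 1 ∧ ∀ w ∈ W, e ⬝ᵥ w = 0 := by
  let T := (WithLp.linearEquiv 2 ℝ (Fin n → ℝ)).toLinearMap
  have hle : W.comap T ≤ K.comap T := Submodule.comap_mono hWK.le
  have hne : (W.comap T)ᗮ ⊓ K.comap T ≠ ⊥ := by
    intro h
    have hsup := Submodule.sup_orthogonal_inf_of_hasOrthogonalProjection hle
    rw [h, sup_bot_eq] at hsup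
    exact hWK.ne
      (Submodule.comap_injective_of_surjective (WithLp.linearEquiv 2 ℝ (Fin n → ℝ)).surjective hsup)
  obtain ⟨x, hx, hx0⟩ := Submodule.exists_mem_ne_zero_of_ne_bot hne
  have hdot : x.ofLp ⬝ᵥ x.ofLp = ‖x‖ ^ 2 := by
    rw [EuclideanSpace.real_norm_sq_eq]
    simp [dotProduct, sq]
  have hnorm : ‖x‖ ≠ 0 := norm_ne_zero_iff.2 hx0
  refine ⟨‖x‖⁻¹ • x.ofLp, K.smul_mem _ hx.2, ?_, fun w hw => ?_⟩
  · rw [smul_dotProduct, dotProduct_smul, hdot]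
    simp only [smul_eq_mul]
    field_simp
  · have hxw := (Submodule.mem_orthogonal' _ _).1 hx.1 (WithLp.toLp 2 w) hw
    rw [EuclideanSpace.inner_eq_star_dotProduct, dotProduct_comm] at hxw
    rw [smul_dotProduct]
    simpa using Or.inr hxw

/-- The bound for the last successive minimum of the integer lattice in the kernel of `A`. -/
noncomputable def minimumBound {m n : ℕ} (k : ℕ) (A : Matrix (Fin m) (Fin n) ℤ) : ℝ :=
  2 ^ k * √((A * Aᵀ).det : ℤ) / ballVolume k

theorem minimumBound_nonneg {m n : ℕ} (k : ℕ) (A : Matrix (Fin m) (Fin n) ℤ) :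
    0 ≤ minimumBound k A :=
  div_nonneg (by positivity) (ballVolume_pos k).le

/-- The integer vectors of the kernel of `A` of length at most `minimumBound k A`. -/
def shortKernelVectors {m n : ℕ} (k : ℕ) (A : Matrix (Fin m) (Fin n) ℤ) : Set (Fin n → ℝ) :=
  {y | ∃ z : Fin n → ℤ, A *ᵥ z = 0 ∧ y ⬝ᵥ y ≤ minimumBound k A ^ 2 ∧ y = fun j => (z j : ℝ)}

theorem span_shortKernelVectors_le {m n : ℕ} (k : ℕ) (A : Matrix (Fin m) (Fin n) ℤ) :
    Submodule.span ℝ (shortKernelVectors k A) ≤ LinearMap.ker (toReal A).mulVecLin := by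
  rw [Submodule.span_le]
  rintro _ ⟨z, hz, -, rfl⟩
  change toReal A *ᵥ _ = 0
  rw [intCast_mulVec, hz]
  ext
  simp

/-- The short integer vectors of the kernel of `A` span the kernel. -/
theorem span_shortKernelVectors {m n k : ℕ} (hn : n = m + k) (hk : 0 < k)
    (A : Matrix (Fin m) (Fin n) ℤ) (hA : Function.Surjective (toReal A).mulVec) :
    Submodule.span ℝ (shortKernelVectors k A) = LinearMap.ker (toReal A).mulVecLin := by
  by_contra hne
  obtain ⟨e, heK, he1, heW⟩ := exists_unit_dotProduct_eq_zero
    (lt_of_le_of_ne (span_shortKernelVectors_le k A) hne)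
  set r := minimumBound k A with hr
  have hr0 : 0 ≤ r := minimumBound_nonneg k A
  -- The least integer above r²: an integer vector longer than r has squared length at least q.
  set q : ℤ := ⌊r ^ 2⌋ + 1 with hq
  have hrq : r ^ 2 < q := by
    rw [hq, Int.cast_add, Int.cast_one]
    exact Int.lt_floor_add_one (r ^ 2)
  have hq1 : (1 : ℝ) ≤ q := by
    have : (0 : ℤ) < q := by exact_mod_cast (sq_nonneg r).trans_lt hrq
    exact_mod_cast this
  have hq0 : (0 : ℝ) < q := one_pos.trans_le hq1
  have hρ : √(q : ℝ) ^ 2 = q := Real.sq_sqrt hq0.le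
  obtain ⟨z, hz0, hz, hlt⟩ := exists_int_mem_ker_mem_ellipsoid hn hk A hA e heK he1 √(q : ℝ)
    (Real.sqrt_pos.2 hq0) (by
      have : r < √(q : ℝ) := Real.lt_sqrt_of_sq_lt hrq
      rwa [hr, minimumBound, div_lt_iff₀' (ballVolume_pos k)] at this)
  rw [hρ] at hlt
  set y : Fin n → ℝ := fun j => (z j : ℝ) with hy
  have hyz : y ⬝ᵥ y = ((z ⬝ᵥ z : ℤ) : ℝ) := by simp [hy, dotProduct]
  have hz1 : 1 ≤ z ⬝ᵥ z :=
    lt_of_le_of_ne (Finset.sum_nonneg fun i _ => mul_self_nonneg _)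
      fun h => hz0 (dotProduct_self_eq_zero.1 h.symm)
  rcases le_or_gt (y ⬝ᵥ y) (r ^ 2) with hle | hgt
  · have hey := heW y (Submodule.subset_span ⟨z, hz, hle, rfl⟩)
    rw [hey, hyz] at hlt
    have : ((z ⬝ᵥ z : ℤ) : ℝ) < 1 := by simpa using hlt
    have : z ⬝ᵥ z < 1 := by exact_mod_cast this
    omega
  · have hqy : (q : ℝ) ≤ y ⬝ᵥ y := by
      rw [hyz] at hgt ⊢
      exact_mod_cast Int.floor_lt.2 hgt
    have hcs : (e ⬝ᵥ y) ^ 2 ≤ y ⬝ᵥ y := by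
      have := Finset.sum_mul_sq_le_sq_mul_sq Finset.univ e y
      simp only [sq (e _), sq (y _)] at this
      calc (e ⬝ᵥ y) ^ 2 ≤ (e ⬝ᵥ e) * (y ⬝ᵥ y) := this
        _ = y ⬝ᵥ y := by rw [he1, one_mul]
    -- Since q ≥ 1, shrinking every direction by √q, not only e, bounds the ellipsoid form below by
    -- |y|²/q ≥ 1.
    have h1 : 1 ≤ (y ⬝ᵥ y) / q := (one_le_div hq0).2 hqy
    have h2 : (y ⬝ᵥ y - (e ⬝ᵥ y) ^ 2) / q ≤ y ⬝ᵥ y - (e ⬝ᵥ y) ^ 2 :=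
      div_le_self (sub_nonneg.2 hcs) hq1
    rw [sub_div] at h2
    linarith

/-! ### Rounding and admissibility -/

/-- Every point of the kernel of `A` is close to an integer point of the kernel. -/
theorem exists_int_mem_ker_abs_sub_le {m n k : ℕ} (hn : n = m + k) (hk : 0 < k)
    (A : Matrix (Fin m) (Fin n) ℤ) (hA : Function.Surjective (toReal A).mulVec)
    (x : Fin n → ℝ) (hx : toReal A *ᵥ x = 0) :
    ∃ z : Fin n → ℤ, A *ᵥ z = 0 ∧ ∀ j, |x j - z j| ≤ k * minimumBound k A / 2 := by
  have hspan := span_shortKernelVectors hn hk A hA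
  obtain ⟨b, hbS, hb, hli⟩ := exists_linearIndependent ℝ (shortKernelVectors k A)
  rw [hspan] at hb
  have hfin : b.Finite := hli.setFinite
  lift b to Finset (Fin n → ℝ) using hfin
  have hcard : b.card = k := by
    have h1 := finrank_span_finset_eq_card hli
    have h2 := (toReal A).mulVecLin.finrank_range_add_finrank_ker
    rw [← hb, h1, LinearMap.range_eq_top.2 hA, finrank_top] at h2
    simp at h2
    omega
  have hxb : x ∈ Submodule.span ℝ (b : Set (Fin n → ℝ)) := by
    rw [hb]
    exact hx
  obtain ⟨c, -, hc⟩ := Submodule.mem_span_finset.1 hxb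
  have hex : ∀ y : Fin n → ℝ, ∃ z : Fin n → ℤ, y ∈ b →
      A *ᵥ z = 0 ∧ y ⬝ᵥ y ≤ minimumBound k A ^ 2 ∧ y = fun j => (z j : ℝ) := by
    intro y
    by_cases hy : y ∈ b
    · obtain ⟨z, hz⟩ := hbS hy
      exact ⟨z, fun _ => hz⟩
    · exact ⟨0, fun h => absurd h hy⟩
  choose f hf using hex
  -- Each of the k coefficients moves by at most 1/2, and no entry of a basis vector exceeds its
  -- length.
  refine ⟨∑ y ∈ b, round (c y) • f y, ?_, fun j => ?_⟩
  · rw [mulVec_sum]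
    refine Finset.sum_eq_zero fun y hy => ?_
    rw [mulVec_smul, (hf y hy).1, smul_zero]
  · have hsub : x j - ((∑ y ∈ b, round (c y) • f y) j : ℤ) =
        ∑ y ∈ b, (c y - round (c y)) * y j := by
      simp only [← hc, Finset.sum_apply, Pi.smul_apply, smul_eq_mul, Int.cast_sum, Int.cast_mul,
        ← Finset.sum_sub_distrib]
      refine Finset.sum_congr rfl fun y hy => ?_
      have : y j = f y j := congrFun (hf y hy).2.2 j
      rw [← this]
      ring
    rw [hsub]
    calc |∑ y ∈ b, (c y - round (c y)) * y j|
        ≤ ∑ y ∈ b, |(c y - round (c y)) * y j| := Finset.abs_sum_le_sum_abs _ _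
      _ ≤ ∑ _y ∈ b, 1 / 2 * minimumBound k A := by
        refine Finset.sum_le_sum fun y hy => ?_
        rw [abs_mul]
        refine mul_le_mul (abs_sub_round _) ?_ (abs_nonneg _) (by norm_num)
        refine abs_le_of_sq_le_sq ?_ (minimumBound_nonneg k A)
        calc y j ^ 2 = y j * y j := sq _
          _ ≤ y ⬝ᵥ y := Finset.single_le_sum (f := fun i => y i * y i)
            (fun i _ => mul_self_nonneg _) (Finset.mem_univ j)
          _ ≤ _ := (hf y hy).2.1
      _ = k * minimumBound k A / 2 := by
        rw [Finset.sum_const, hcard, nsmul_eq_mul]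
        ring

theorem surjective_toReal_mulVec {m n : ℕ} (A : Matrix (Fin m) (Fin n) ℤ)
    (hgcd : minorsGcd A = 1) : Function.Surjective (toReal A).mulVec := by
  intro y
  choose Z hZ using fun i : Fin m => exists_int_mulVec_eq A hgcd (Pi.single i 1)
  refine ⟨∑ i, y i • fun j => (Z i j : ℝ), ?_⟩
  rw [mulVec_sum]
  simp only [mulVec_smul, intCast_mulVec, hZ]
  ext i
  simp [Pi.single_apply]

theorem frobeniusConst_mul_sqrt {m n : ℕ} (hmn : m < n) (A : Matrix (Fin m) (Fin n) ℤ) :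
    frobeniusConst m n * √((A * Aᵀ).det : ℤ) =
      ((n - m : ℕ) : ℝ) * minimumBound (n - m) A / 2 := by
  rw [frobeniusConst, minimumBound, Nat.cast_sub hmn.le]
  obtain ⟨l, hl⟩ : ∃ l, n - m = l + 1 := ⟨n - m - 1, by omega⟩
  rw [hl, Nat.add_sub_cancel, pow_succ]
  ring

theorem mulVec_eq_sum_column {m n : ℕ} (A : Matrix (Fin m) (Fin n) ℤ) (x : Fin n → ℝ) :
    toReal A *ᵥ x = ∑ j, x j • column A j := by
  ext i
  simp [toReal, column, mulVec, dotProduct, mul_comm]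

/-- The real solution t + c has slack t in every entry, exactly the rounding error allowed when it
is moved to an integer solution. -/
theorem frobeniusConst_mul_sqrt_mem_admissibleShifts {m n : ℕ} (hmn : m < n)
    (A : Matrix (Fin m) (Fin n) ℤ) (hgcd : minorsGcd A = 1) :
    frobeniusConst m n * √((A * Aᵀ).det : ℤ) ∈ admissibleShifts A := by
  rw [frobeniusConst_mul_sqrt hmn]
  set t := ((n - m : ℕ) : ℝ) * minimumBound (n - m) A / 2 with ht
  refine ⟨by have := minimumBound_nonneg (n - m) A; positivity, ?_⟩
  rintro b ⟨_, ⟨c, hc, rfl⟩, hb⟩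
  obtain ⟨z, hz⟩ := exists_int_mulVec_eq A hgcd b
  have hx : toReal A *ᵥ (fun j => t + c j) = fun i => (b i : ℝ) := by
    rw [hb, mulVec_eq_sum_column, columnSum, Finset.smul_sum, ← Finset.sum_add_distrib]
    simp only [add_smul]
  have hker : toReal A *ᵥ ((fun j => t + c j) - fun j => (z j : ℝ)) = 0 := by
    rw [mulVec_sub, hx, intCast_mulVec, hz, sub_self]
  obtain ⟨l, hl, hdist⟩ := exists_int_mem_ker_abs_sub_le (k := n - m) (by omega) (by omega) A
    (surjective_toReal_mulVec A hgcd) _ hker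
  refine ⟨z + l, fun j => ?_, ?_⟩
  · have h := (abs_le.1 (hdist j)).2
    simp only [Pi.sub_apply, ← ht] at h
    simp only [Pi.add_apply, Int.cast_add]
    linarith [hc j]
  · rw [intCast_mulVec, mulVec_add, hz, hl, add_zero]

end Knapsack

theorem mainTheorem1 (m n : ℕ) (hm : 1 ≤ m) (hmn : m < n) (A : Matrix (Fin m) (Fin n) ℤ)
    (hgcd : Knapsack.minorsGcd A = 1)
    (hcone : {x : Fin n → ℝ | (∀ j, 0 ≤ x j) ∧ (Knapsack.toReal A).mulVec x = 0} = {0}) :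
    Knapsack.diagFrobenius A
        ≤ Knapsack.frobeniusConst m n * Real.sqrt (((A * A.transpose).det : ℤ) : ℝ) ∧
      Knapsack.frobeniusConst m n * Real.sqrt (((A * A.transpose).det : ℤ) : ℝ)
        ∈ Knapsack.admissibleShifts A := by
  have hmem := Knapsack.frobeniusConst_mul_sqrt_mem_admissibleShifts hmn A hgcd
  exact ⟨csInf_le ⟨0, fun _ ht => ht.1⟩ hmem, hmem⟩
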